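/- **Theorem.** Let $\Gamma$ be a finite, simple, connected, undirected, non-bipartite distance-regular graph with vertex set $X$, path-length distance $\partial$, diameter $D\ge 3$ and intersection numbers $p^h_{ij}=|\{w:\partial(y,w)=i,\ \partial(z,w)=j\}|$ for $\partial(y,z)=h$; write $c_i=p^i_{1,i-1}$, $a_i=p^i_{1,i}$, $b_i=p^i_{1,i+1}$. Suppose that $\Gamma$ is of negative type, that is, there are real numbers $q,\alpha,\beta$ with $q<-1$ such that, with $[j]=1+q+\cdots+q^{j-1}$, $$c_i=[i]\,(1+\alpha[i-1])\quad(1\le i\le D),\qquad b_i=([D]-[i])(\beta-\alpha[i])\quad(0\le i\le D-1),$$ and suppose that $a_1=0$. Then, for every vertex $x\in X$, $\Gamma$ does not support a uniform structure with respect to $x$. Here $\Gamma$ is said to support a uniform structure with respect to $x$ if the following holds. Let $\Gamma_f$ be the bipartite graph obtained from $\Gamma$ by deleting all edges $yz$ with $\partial(x,y)=\partial(x,z)$, let $A$ be its adjacency matrix over $\mathbb C$, let $\varepsilon$ be the eccentricity of $x$ in $\Gamma_f$, let $E_i^*$ be the diagonal matrix with $(y,y)$-entry $1$ if $y$ has distance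 $i$ from $x$ in $\Gamma_f$ and $0$ otherwise, let $V=\mathbb C^X$, and put $L=\sum_{i=1}^{\varepsilon}E^*_{i-1}AE^*_i$ and $R=\sum_{i=0}^{\varepsilon-1}E^*_{i+1}AE^*_i$. Then there are a vector $(f_i)_{i=1}^{\varepsilon}\in\mathbb C^{\varepsilon}$ and a complex tridiagonal matrix $U=(e_{ij})_{1\le i,j\le\varepsilon}$ such that 1. $e_{ii}=1$ for $1\le i\le\varepsilon$; 2. either $e_{i,i-1}\ne0$ for all $2\le i\le\varepsilon$, or $e_{i-1,i}\ne0$ for all $2\le i\le\varepsilon$; 3. the principal submatrix $(e_{ij})_{s\le i,j\le t}$ is nonsingular whenever $1\le s\le t\le\varepsilon$; 4. for $1\le i\le\varepsilon$, the equation $e_i^-RL^2+LRL+e_i^+L^2R=f_iL$ holds on $E_i^*V$, where $e_i^-=e_{i,i-1}$ for $2\le i\le\varepsilon$, $e_i^+=e_{i,i+1}$ for $1\le i\le\varepsilon-1$, and $e_1^-=e_\varepsilon^+=0$. -/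

import Mathlib

open Matrix

namespace SimpleGraph

variable {X : Type*}

/-- `G` is a (connected) distance-regular graph with intersection numbers
`p h i j = p^h_{ij}` for `0 ≤ h, i, j ≤ D`, where `D` is the diameter. The values of `p` at
indices larger than `D` carry no meaning. -/
def IsDistanceRegularWith (G : SimpleGraph X) (p : ℕ → ℕ → ℕ → ℕ) : Prop :=
  G.Connected ∧
    ∀ h i j : ℕ, h ≤ G.diam → i ≤ G.diam → j ≤ G.diam →
      ∀ y z : X, G.dist y z = h → {w : X | G.dist y w = i ∧ G.dist z w = j}.ncard = p h i j

/-- The bracket `[j; 1] = 1 + q + q ^ 2 + ⋯ + q ^ (j - 1)`. -/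
noncomputable def qBracket (q : ℝ) (j : ℕ) : ℝ := ∑ k ∈ Finset.range j, q ^ k

/-- The intersection numbers `c_i = p^i_{1,i-1}` and `b_i = p^i_{1,i+1}` are those of a graph
with classical parameters `(D, q, α, β)`. -/
def HasClassicalParameters (p : ℕ → ℕ → ℕ → ℕ) (D : ℕ) (q α β : ℝ) : Prop :=
  (∀ i : ℕ, 1 ≤ i → i ≤ D →
    (p i 1 (i - 1) : ℝ) = qBracket q i * (1 + α * qBracket q (i - 1))) ∧
  (∀ i : ℕ, i < D →
    (p i 1 (i + 1) : ℝ) = (qBracket q D - qBracket q i) * (β - α * qBracket q i))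

/-- The graph with intersection numbers `p` and diameter `D` is of negative type. -/
def IsNegativeType (p : ℕ → ℕ → ℕ → ℕ) (D : ℕ) : Prop :=
  ∃ q α β : ℝ, HasClassicalParameters p D q α β ∧ q < -1

/-- The eccentricity `ε(x)` as a natural number (for a finite connected graph). -/
noncomputable def eccentricity (G : SimpleGraph X) (x : X) : ℕ := (G.eccent x).toNat

/-- The adjacency matrix with complex entries. -/
noncomputable def complexAdjMatrix (G : SimpleGraph X) : Matrix X X ℂ :=
  open Classical in G.adjMatrix ℂ

/-- The dual idempotent `E*_i` with respect to `x`. -/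
noncomputable def dualIdempotent [DecidableEq X] (G : SimpleGraph X) (x : X) (i : ℕ) :
    Matrix X X ℂ :=
  Matrix.diagonal fun y => if G.dist x y = i then 1 else 0

/-- The subconstituent `E*_i V`, where `V = ℂ^X` is the standard module. -/
noncomputable def subconstituent [Fintype X] [DecidableEq X] (G : SimpleGraph X) (x : X) (i : ℕ) :
    Submodule ℂ (X → ℂ) :=
  LinearMap.range (Matrix.mulVecLin (G.dualIdempotent x i))

/-- The lowering matrix `L` with respect to `x`. -/
noncomputable def loweringMatrix [Fintype X] [DecidableEq X] (G : SimpleGraph X) (x : X) :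
    Matrix X X ℂ :=
  ∑ i ∈ Finset.Icc 1 (G.eccentricity x),
    G.dualIdempotent x (i - 1) * G.complexAdjMatrix * G.dualIdempotent x i

/-- The raising matrix `R` with respect to `x`. -/
noncomputable def raisingMatrix [Fintype X] [DecidableEq X] (G : SimpleGraph X) (x : X) :
    Matrix X X ℂ :=
  ∑ i ∈ Finset.range (G.eccentricity x),
    G.dualIdempotent x (i + 1) * G.complexAdjMatrix * G.dualIdempotent x i

/-- `U = (e_{ij})_{1 ≤ i, j ≤ ε}` is a parameter matrix. The matrix is written with natural
number indices; only the entries with indices in `1, …, ε` are used. -/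
structure IsParameterMatrix (ε : ℕ) (U : Matrix ℕ ℕ ℂ) : Prop where
  tridiagonal : ∀ i ∈ Finset.Icc 1 ε, ∀ j ∈ Finset.Icc 1 ε, i + 1 < j ∨ j + 1 < i → U i j = 0
  diag : ∀ i ∈ Finset.Icc 1 ε, U i i = 1
  off_diag : (∀ i ∈ Finset.Icc 2 ε, U i (i - 1) ≠ 0) ∨ (∀ i ∈ Finset.Icc 2 ε, U (i - 1) i ≠ 0)
  nonsingular : ∀ s t : ℕ, 1 ≤ s → s ≤ t → t ≤ ε →
    (U.submatrix (fun i : Finset.Icc s t => (i : ℕ)) (fun j : Finset.Icc s t => (j : ℕ))).det ≠ 0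

/-- `e⁻_i = e_{i,i-1}` for `2 ≤ i ≤ ε`, with the convention `e⁻_1 = 0`. -/
noncomputable def eMinus (U : Matrix ℕ ℕ ℂ) (i : ℕ) : ℂ := if 2 ≤ i then U i (i - 1) else 0

/-- `e⁺_i = e_{i,i+1}` for `1 ≤ i ≤ ε - 1`, with the convention `e⁺_ε = 0`. -/
noncomputable def ePlus (ε : ℕ) (U : Matrix ℕ ℕ ℂ) (i : ℕ) : ℂ := if i < ε then U i (i + 1) else 0

/-- `(U, f)` is a uniform structure of the (bipartite) graph `G` with respect to `x`:
`U` is a parameter matrix and `e⁻_i R L² + L R L + e⁺_i L² R = f_i L` holds on `E*_i V`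
for `1 ≤ i ≤ ε`. -/
structure IsUniformStructure [Fintype X] [DecidableEq X] (G : SimpleGraph X) (x : X)
    (U : Matrix ℕ ℕ ℂ) (f : ℕ → ℂ) : Prop where
  isParameterMatrix : IsParameterMatrix (G.eccentricity x) U
  uniform : ∀ i ∈ Finset.Icc 1 (G.eccentricity x), ∀ v ∈ G.subconstituent x i,
    (eMinus U i • (G.raisingMatrix x * G.loweringMatrix x ^ 2)
      + G.loweringMatrix x * G.raisingMatrix x * G.loweringMatrix x
      + ePlus (G.eccentricity x) U i • (G.loweringMatrix x ^ 2 * G.raisingMatrix x)) *ᵥ v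
      = (f i • G.loweringMatrix x) *ᵥ v

/-- The graph `G_f(x)`: delete all edges `yz` of `G` with `∂(x, y) = ∂(x, z)`. -/
def flatDeleted (G : SimpleGraph X) (x : X) : SimpleGraph X where
  Adj y z := G.Adj y z ∧ G.dist x y ≠ G.dist x z
  symm := ⟨fun _ _ h => ⟨h.1.symm, h.2.symm⟩⟩
  loopless := ⟨fun _ h => h.2 rfl⟩

/-- The graph `G` supports a uniform structure with respect to `x`. -/
def SupportsUniformStructure [Fintype X] [DecidableEq X] (G : SimpleGraph X) (x : X) : Prop :=
  ∃ (U : Matrix ℕ ℕ ℂ) (f : ℕ → ℂ), (G.flatDeleted x).IsUniformStructure x U f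

end SimpleGraph

/-!
For `q < -1` the matrix with entries `q⁻¹ ^ ∂(u, v)`, shifted by a constant, is a positive multiple
of a primitive idempotent, hence positive semidefinite. For `y, z` at distance `n` consider the sum
of the characteristic vectors of the neighbours of `y` closer to `z`, minus the same sum with `y`
and `z` exchanged, corrected by a multiple of the difference of the vectors of `y` and `z`. Since
`a₁ = 0`, its quadratic form is nonpositive for odd `n`, so that for `n = 3` it lies in the kernel
of the shifted matrix (the balanced set condition); the case `n = 4` follows from `n = 3` by summing
over neighbours. Where the condition holds, there are no parallelograms of length `n`.

Let `x, z` be adjacent. Without parallelograms, the raising and lowering operators with respect to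
`x` preserve functions of `(∂(x, y), ∂(z, y))`, with coefficients given by the parameters. Hence the
uniform relation on the third subconstituent, evaluated at a vertex `y` with `∂(x, y) = 2` and
`∂(z, y) = 2`, respectively `∂(z, y) = 1`, gives two linear equations for its coefficient `e⁻`, and
these are incompatible.
-/

namespace DistanceRegular

open SimpleGraph Finset

section Neighbours

variable {X : Type*} {G : SimpleGraph X} {w x y z : X}

lemma dist_right_cases (h : G.Adj y w) (x : X) :
    G.dist x w + 1 = G.dist x y ∨ G.dist x w = G.dist x y ∨ G.dist x w = G.dist x y + 1 := by
  have := h.diff_dist_adj (u := x)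
  omega

lemma dist_left_cases (h : G.Adj x z) (w : X) :
    G.dist z w + 1 = G.dist x w ∨ G.dist z w = G.dist x w ∨ G.dist z w = G.dist x w + 1 := by
  simpa only [G.dist_comm (v := w)] using dist_right_cases h w

lemma sum_dist_of_adj {S : Finset X} (hS : ∀ w ∈ S, G.Adj y w) (x : X) (F : ℕ → ℝ) :
    ∑ w ∈ S, F (G.dist x w) =
      #{w ∈ S | G.dist x w + 1 = G.dist x y} * F (G.dist x y - 1) +
        #{w ∈ S | G.dist x w = G.dist x y} * F (G.dist x y) +
        #{w ∈ S | G.dist x w = G.dist x y + 1} * F (G.dist x y + 1) := by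
  have hterm : ∀ w ∈ S, F (G.dist x w) =
      (if G.dist x w + 1 = G.dist x y then F (G.dist x y - 1) else 0) +
      (if G.dist x w = G.dist x y then F (G.dist x y) else 0) +
      (if G.dist x w = G.dist x y + 1 then F (G.dist x y + 1) else 0) := by
    intro w hw
    rcases dist_right_cases (hS w hw) x with h | h | h
    · simp [← h, add_assoc]
    · simp [h]
    · simp [h, add_assoc]
  simp only [sum_congr rfl hterm, sum_add_distrib, ← sum_filter, sum_const, nsmul_eq_mul]

lemma card_eq_of_adj {S : Finset X} (hS : ∀ w ∈ S, G.Adj y w) (x : X) :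
    (#S : ℝ) = #{w ∈ S | G.dist x w + 1 = G.dist x y} + #{w ∈ S | G.dist x w = G.dist x y} +
      #{w ∈ S | G.dist x w = G.dist x y + 1} := by
  simpa using sum_dist_of_adj hS x 1

lemma exists_adj_dist_add_one (hG : G.Connected) (h : x ≠ y) :
    ∃ w, G.Adj y w ∧ G.dist x w + 1 = G.dist x y := by
  obtain ⟨p, hp⟩ := hG.exists_walk_length_eq_dist y x
  cases p with
  | nil => exact absurd rfl h
  | @cons _ w _ hyw p =>
    refine ⟨w, hyw, ?_⟩
    have hwx : G.dist w x ≤ p.length := dist_le p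
    have hxw := dist_right_cases hyw x
    rw [Walk.length_cons, dist_comm] at hp
    rw [dist_comm] at hwx
    omega

variable [Fintype X]

open Classical in
/-- The neighbours of `y` at distance `∂(x, y) - 1` from `x`, which are counted by `c_i` for
`i = ∂(x, y)`. -/
noncomputable def lowerNbrs (G : SimpleGraph X) (x y : X) : Finset X :=
  {w | G.Adj y w ∧ G.dist x w + 1 = G.dist x y}

open Classical in
/-- The neighbours of `y` at distance `∂(x, y) + 1` from `x`, which are counted by `b_i` for
`i = ∂(x, y)`. -/
noncomputable def upperNbrs (G : SimpleGraph X) (x y : X) : Finset X :=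
  {w | G.Adj y w ∧ G.dist x w = G.dist x y + 1}

@[simp]
lemma mem_lowerNbrs : w ∈ lowerNbrs G x y ↔ G.Adj y w ∧ G.dist x w + 1 = G.dist x y := by
  simp [lowerNbrs]

@[simp]
lemma mem_upperNbrs : w ∈ upperNbrs G x y ↔ G.Adj y w ∧ G.dist x w = G.dist x y + 1 := by
  simp [upperNbrs]

lemma lowerNbrs_nonempty (hG : G.Connected) (h : x ≠ y) : (lowerNbrs G x y).Nonempty := by
  obtain ⟨w, hw⟩ := exists_adj_dist_add_one hG h
  exact ⟨w, mem_lowerNbrs.2 hw⟩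

variable [DecidableRel G.Adj]

lemma filter_neighborFinset_lower :
    {w ∈ G.neighborFinset y | G.dist x w + 1 = G.dist x y} = lowerNbrs G x y := by
  ext w; simp

lemma filter_neighborFinset_upper :
    {w ∈ G.neighborFinset y | G.dist x w = G.dist x y + 1} = upperNbrs G x y := by
  ext w; simp

lemma sum_neighborFinset_dist (F : ℕ → ℝ) (x y : X) :
    ∑ w ∈ G.neighborFinset y, F (G.dist x w) =
      #(G.neighborFinset y) * F (G.dist x y) +
        #(lowerNbrs G x y) * (F (G.dist x y - 1) - F (G.dist x y)) +
        #(upperNbrs G x y) * (F (G.dist x y + 1) - F (G.dist x y)) := by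
  have hadj : ∀ w ∈ G.neighborFinset y, G.Adj y w := fun w => (G.mem_neighborFinset y w).1
  rw [card_eq_of_adj hadj x, sum_dist_of_adj hadj, filter_neighborFinset_lower,
    filter_neighborFinset_upper]
  ring

lemma sum_neighborFinset_comm (g : X → ℝ) :
    ∑ u, ∑ w ∈ G.neighborFinset u, g w = ∑ w, #(G.neighborFinset w) * g w := by
  rw [sum_comm' (t' := univ) (s' := fun w => G.neighborFinset w) (by simp [adj_comm])]
  simp only [sum_const, nsmul_eq_mul]

end Neighbours

section IntersectionArray

variable {X : Type*} [Fintype X] {G : SimpleGraph X} {b c : ℕ → ℝ} {x y : X}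

/-- `G` is a connected graph in which the numbers `b_i` and `c_i` of a distance-regular graph are
well defined and equal to `b i` and `c i`; the values of `b` and `c` at indices that are not the
distance of two vertices carry no meaning. -/
structure HasIntersectionArray (G : SimpleGraph X) (b c : ℕ → ℝ) : Prop where
  connected : G.Connected
  card_lowerNbrs : ∀ x y, (#(lowerNbrs G x y) : ℝ) = c (G.dist x y)
  card_upperNbrs : ∀ x y, (#(upperNbrs G x y) : ℝ) = b (G.dist x y)

namespace HasIntersectionArray

lemma card_neighborFinset [DecidableRel G.Adj] (h : HasIntersectionArray G b c) (x : X) :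
    (#(G.neighborFinset x) : ℝ) = b 0 := by
  have hx : upperNbrs G x x = G.neighborFinset x := by ext w; simp
  rw [← hx, h.card_upperNbrs, dist_self]

lemma exists_adj_dist_eq (h : HasIntersectionArray G b c)
    (hne : c (G.dist x y) + b (G.dist x y) ≠ b 0) : ∃ w, G.Adj y w ∧ G.dist x w = G.dist x y := by
  classical
  by_contra! hw
  refine hne ?_
  have hflat : {w ∈ G.neighborFinset y | G.dist x w = G.dist x y} = ∅ :=
    filter_false_of_mem fun w hyw => hw w ((G.mem_neighborFinset y w).1 hyw)
  rw [← h.card_neighborFinset y, card_eq_of_adj (fun w => (G.mem_neighborFinset y w).1) x, hflat,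
    filter_neighborFinset_lower, filter_neighborFinset_upper, h.card_lowerNbrs, h.card_upperNbrs]
  simp

end HasIntersectionArray

/-- The action of the intersection matrix of the array `(b, c)` on a function of the distance: the
coefficient `b₀ - b_i - c_i` of `θ i` is the number `a_i`. -/
def arrayAction (b c θ : ℕ → ℝ) (i : ℕ) : ℝ :=
  b 0 * θ i + c i * (θ (i - 1) - θ i) + b i * (θ (i + 1) - θ i)

end IntersectionArray

section DistanceMatrices

variable {X : Type*} [Fintype X] {G : SimpleGraph X} {b c θ ρ : ℕ → ℝ} {lam μ : ℝ}

/-- The matrix with entries `θ (∂(u, v))`, an element of the Bose–Mesner algebra of a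
distance-regular graph. -/
noncomputable def distMatrix (G : SimpleGraph X) (θ : ℕ → ℝ) : Matrix X X ℝ :=
  of fun u v => θ (G.dist u v)

lemma adjMatrix_mul_distMatrix_apply [DecidableRel G.Adj] (θ : ℕ → ℝ) (u v : X) :
    (G.adjMatrix ℝ * distMatrix G θ) u v = ∑ w ∈ G.neighborFinset u, θ (G.dist v w) := by
  simp [distMatrix, adjMatrix_mul_apply, dist_comm (v := v)]

lemma HasIntersectionArray.adjMatrix_mul_distMatrix [DecidableRel G.Adj]
    (h : HasIntersectionArray G b c) (θ : ℕ → ℝ) :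
    G.adjMatrix ℝ * distMatrix G θ = distMatrix G (arrayAction b c θ) := by
  ext u v
  rw [adjMatrix_mul_distMatrix_apply, sum_neighborFinset_dist, h.card_neighborFinset,
    h.card_lowerNbrs, h.card_upperNbrs, dist_comm]
  rfl

lemma distMatrix_eq_zero [DecidableRel G.Adj] (hG : G.Connected)
    (hθ : G.adjMatrix ℝ * distMatrix G θ = lam • distMatrix G θ) (h₀ : θ 0 = 0) :
    distMatrix G θ = 0 := by
  suffices ∀ n u v, G.dist u v = n → θ n = 0 from ext fun u v => this _ u v rfl
  intro n
  induction n using Nat.strong_induction_on with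
  | _ n ih =>
    intro u v huv
    rcases n with _ | n
    · exact h₀
    obtain ⟨w, hw⟩ := lowerNbrs_nonempty hG (G := G) (x := u) (y := v) (by rintro rfl; simp at huv)
    rw [mem_lowerNbrs] at hw
    have hle : ∀ z, G.dist u z ≤ n → θ (G.dist u z) = 0 := fun z hz => ih _ (by omega) u z rfl
    have hsum : ∑ z ∈ G.neighborFinset w, θ (G.dist u z) = 0 := by
      rw [← adjMatrix_mul_distMatrix_apply, hθ, Matrix.smul_apply, distMatrix, of_apply, dist_comm,
        hle w (by omega), smul_zero]
    have hupper : ∑ z ∈ upperNbrs G u w, θ (G.dist u z) = 0 := by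
      rw [← hsum]
      refine sum_subset (fun z hz => by simp_all) fun z hz hz' => hle z ?_
      have := dist_right_cases ((G.mem_neighborFinset w z).1 hz) u
      rw [mem_upperNbrs, ← mem_neighborFinset, not_and] at hz'
      have := hz' hz
      omega
    rw [sum_congr rfl fun z hz => by rw [(mem_upperNbrs.1 hz).2, show G.dist u w = n by omega],
      sum_const, smul_eq_zero, card_eq_zero] at hupper
    exact hupper.resolve_left (ne_empty_of_mem (a := v) (by simp [hw.1.symm, hw.2]))

omit [Fintype X] in
lemma dist_le_diam_of_isDistanceRegularWith [Finite X] {p : ℕ → ℕ → ℕ → ℕ}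
    (h : G.IsDistanceRegularWith p) (u v : X) : G.dist u v ≤ G.diam :=
  have := h.1.nonempty
  dist_le_diam (connected_iff_ediam_ne_top.1 h.1)

lemma exists_distMatrix_mul_distMatrix {p : ℕ → ℕ → ℕ → ℕ} (h : G.IsDistanceRegularWith p)
    (θ η : ℕ → ℝ) : ∃ ζ, distMatrix G θ * distMatrix G η = distMatrix G ζ := by
  classical
  have hle := dist_le_diam_of_isDistanceRegularWith h
  let I := range (G.diam + 1) ×ˢ range (G.diam + 1)
  refine ⟨fun n => ∑ t ∈ I, p n t.1 t.2 * (θ t.1 * η t.2), ext fun u v => ?_⟩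
  simp only [mul_apply, distMatrix, of_apply, G.dist_comm (v := v)]
  rw [← sum_fiberwise_of_maps_to (t := I) (g := fun w => (G.dist u w, G.dist v w))
    fun w _ => by simp [I, Nat.lt_succ_of_le (hle _ _)]]
  refine sum_congr rfl fun t ht => ?_
  simp only [I, mem_product, mem_range, Nat.lt_succ_iff] at ht
  rw [G.dist_comm, ← h.2 _ t.1 t.2 (hle u v) ht.1 ht.2 u v rfl, Set.ncard_eq_toFinset_card',
    ← nsmul_eq_mul, ← sum_const]
  refine sum_congr (by ext w; simp [Prod.ext_iff]) fun w hw => ?_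
  rw [Set.mem_toFinset] at hw
  rw [hw.1, hw.2]

lemma posSemidef_distMatrix [DecidableRel G.Adj] {p : ℕ → ℕ → ℕ → ℕ}
    (h : G.IsDistanceRegularWith p)
    (hθ : G.adjMatrix ℝ * distMatrix G θ = lam • distMatrix G θ) (h₀ : 0 < θ 0) :
    (distMatrix G θ).PosSemidef := by
  obtain ⟨ζ, hζ⟩ := exists_distMatrix_mul_distMatrix h θ θ
  obtain ⟨x⟩ := h.1.nonempty
  have hζ₀ : 0 < ζ 0 := by
    have hxx := congr_fun₂ hζ x x
    simp only [mul_apply, distMatrix, of_apply, G.dist_self, G.dist_comm (v := x)] at hxx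
    rw [← hxx]
    exact sum_pos' (fun w _ => mul_self_nonneg _) ⟨x, mem_univ x, by simpa using mul_pos h₀ h₀⟩
  have hsub : distMatrix G (fun n => ζ n - ζ 0 / θ 0 * θ n) =
      distMatrix G ζ - (ζ 0 / θ 0) • distMatrix G θ := rfl
  have hmul : distMatrix G ζ = (ζ 0 / θ 0) • distMatrix G θ := by
    rw [← sub_eq_zero, ← hsub]
    refine distMatrix_eq_zero h.1 (lam := lam) ?_ (by field_simp; simp)
    rw [hsub, Matrix.mul_sub, ← hζ, ← Matrix.mul_assoc, Matrix.mul_smul, hθ, smul_sub,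
      smul_mul_assoc, smul_comm]
  have hsymm : (distMatrix G θ)ᴴ = distMatrix G θ := by
    ext u v
    simp [distMatrix, dist_comm]
  have hsq : distMatrix G θ = (θ 0 / ζ 0) • ((distMatrix G θ)ᴴ * distMatrix G θ) := by
    rw [hsymm, hζ, hmul, smul_smul, div_mul_div_cancel₀ hζ₀.ne', div_self h₀.ne', one_smul]
  rw [hsq]
  exact (posSemidef_conjTranspose_mul_self _).smul (div_pos h₀ hζ₀).le

lemma exists_posSemidef_distMatrix_sub [Nontrivial X] {p : ℕ → ℕ → ℕ → ℕ}
    (h : G.IsDistanceRegularWith p) (ha : HasIntersectionArray G b c)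
    (hρ : ∀ i ≠ 0, ρ i < ρ 0)
    (hrec : ∀ u v, arrayAction b c ρ (G.dist u v) = lam * ρ (G.dist u v) + μ) :
    ∃ m, (distMatrix G fun i => ρ i - m).PosSemidef := by
  classical
  obtain ⟨x⟩ := ha.connected.nonempty
  have hX : (0 : ℝ) < Fintype.card X := by exact_mod_cast Fintype.card_pos
  have hcol (u) : ∑ w ∈ G.neighborFinset u, ρ (G.dist x w) = lam * ρ (G.dist x u) + μ := by
    rw [← adjMatrix_mul_distMatrix_apply, ha.adjMatrix_mul_distMatrix, distMatrix, of_apply, hrec,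
      dist_comm]
  set S := ∑ w, ρ (G.dist x w) with hS
  have hμ : μ = (b 0 - lam) * (S / Fintype.card X) := by
    have hdouble := sum_neighborFinset_comm (G := G) fun w => ρ (G.dist x w)
    simp only [hcol, ha.card_neighborFinset, sum_add_distrib, ← mul_sum, ← hS, sum_const,
      nsmul_eq_mul, card_univ] at hdouble
    field_simp
    linarith
  refine ⟨S / Fintype.card X, posSemidef_distMatrix h (lam := lam) ?_ ?_⟩
  · rw [ha.adjMatrix_mul_distMatrix]
    ext u v
    have := hrec u v
    simp only [arrayAction, distMatrix, of_apply, Matrix.smul_apply, smul_eq_mul] at this ⊢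
    linear_combination this + hμ
  · obtain ⟨y, hy⟩ := exists_ne x
    have hle (w) : ρ (G.dist x w) ≤ ρ 0 := by
      rcases eq_or_ne (G.dist x w) 0 with h | h
      · rw [h]
      · exact (hρ _ h).le
    have hlt : S < Fintype.card X * ρ 0 := by
      rw [← nsmul_eq_mul, ← card_univ, ← sum_const]
      exact sum_lt_sum (fun w _ => hle w)
        ⟨y, mem_univ y, hρ _ (ha.connected.pos_dist_of_ne hy.symm).ne'⟩
    rw [sub_pos, div_lt_iff₀ hX]
    linarith

lemma distMatrix_mulVec_eq_zero (hρ : ∃ m, (distMatrix G fun i => ρ i - m).PosSemidef)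
    {f : X → ℝ} (hf : ∑ v, f v = 0) (hneg : ∀ v, f v * (distMatrix G ρ *ᵥ f) v ≤ 0) :
    distMatrix G ρ *ᵥ f = 0 := by
  obtain ⟨m, hm⟩ := hρ
  have hmul : (distMatrix G fun i => ρ i - m) *ᵥ f = distMatrix G ρ *ᵥ f := by
    ext v
    simp only [mulVec, dotProduct, distMatrix, of_apply, sub_mul, sum_sub_distrib, ← mul_sum, hf,
      mul_zero, sub_zero]
  rw [← hmul, ← hm.dotProduct_mulVec_zero_iff, hmul]
  exact le_antisymm (sum_nonpos fun v _ => hneg v) (hmul ▸ hm.dotProduct_mulVec_nonneg f)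

end DistanceMatrices

section ClassicalParameters

variable {X : Type*} [Fintype X] {G : SimpleGraph X} {p : ℕ → ℕ → ℕ → ℕ} {D : ℕ} {q α β : ℝ}

/-- The intersection number `c_i` of a graph with classical parameters `(D, q, α, β)`. -/
noncomputable def classicalC (q α : ℝ) (i : ℕ) : ℝ := qBracket q i * (1 + α * qBracket q (i - 1))

/-- The intersection number `b_i` of a graph with classical parameters `(D, q, α, β)`. -/
noncomputable def classicalB (D : ℕ) (q α β : ℝ) (i : ℕ) : ℝ :=
  (qBracket q D - qBracket q i) * (β - α * qBracket q i)

lemma qBracket_eq (hq : q ≠ 1) (i : ℕ) : qBracket q i = (q ^ i - 1) / (q - 1) :=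
  geom_sum_eq hq i

lemma qBracket_zero (q : ℝ) : qBracket q 0 = 0 := by
  simp [qBracket]

lemma qBracket_one (q : ℝ) : qBracket q 1 = 1 := by
  simp [qBracket]

lemma qBracket_two (q : ℝ) : qBracket q 2 = 1 + q := by
  simp [qBracket, sum_range_succ]

lemma qBracket_three (q : ℝ) : qBracket q 3 = 1 + q + q ^ 2 := by
  simp [qBracket, sum_range_succ]

lemma qBracket_four (q : ℝ) : qBracket q 4 = 1 + q + q ^ 2 + q ^ 3 := by
  simp [qBracket, sum_range_succ]

lemma classicalC_one (q α : ℝ) : classicalC q α 1 = 1 := by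
  simp [classicalC, qBracket]

lemma card_lowerNbrs_of_hasClassicalParameters (h : G.IsDistanceRegularWith p)
    (hD : 1 ≤ G.diam) (hp : HasClassicalParameters p G.diam q α β) (x y : X) :
    (#(lowerNbrs G x y) : ℝ) = classicalC q α (G.dist x y) := by
  have hle := dist_le_diam_of_isDistanceRegularWith h x y
  rcases Nat.eq_zero_or_pos (G.dist x y) with h₀ | h₀
  · have hempty : lowerNbrs G x y = ∅ := by
      ext w
      simp [h₀]
    simp [hempty, h₀, classicalC, qBracket]
  · rw [classicalC, ← hp.1 _ h₀ hle,
      ← h.2 (G.dist x y) 1 (G.dist x y - 1) hle hD (by omega) y x G.dist_comm,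
      ← Set.ncard_coe_finset]
    congr 2
    ext w
    simp only [mem_coe, mem_lowerNbrs, Set.mem_ofPred_eq, dist_eq_one_iff_adj]
    exact and_congr_right fun _ => by omega

lemma card_upperNbrs_of_hasClassicalParameters (h : G.IsDistanceRegularWith p)
    (hD : 1 ≤ G.diam) (hp : HasClassicalParameters p G.diam q α β) (x y : X) :
    (#(upperNbrs G x y) : ℝ) = classicalB G.diam q α β (G.dist x y) := by
  have hle := dist_le_diam_of_isDistanceRegularWith h
  rcases (hle x y).eq_or_lt with h₀ | h₀
  · have hempty : upperNbrs G x y = ∅ := by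
      ext w
      have := hle x w
      simp only [mem_upperNbrs, notMem_empty, iff_false]
      omega
    simp [hempty, h₀, classicalB]
  · rw [classicalB, ← hp.2 _ h₀,
      ← h.2 (G.dist x y) 1 (G.dist x y + 1) (hle x y) hD h₀ y x G.dist_comm,
      ← Set.ncard_coe_finset]
    congr 2
    ext w
    simp only [mem_coe, mem_upperNbrs, Set.mem_ofPred_eq, dist_eq_one_iff_adj]

lemma hasIntersectionArray_classical (h : G.IsDistanceRegularWith p) (hD : 1 ≤ G.diam)
    (hp : HasClassicalParameters p G.diam q α β) :
    HasIntersectionArray G (classicalB G.diam q α β) (classicalC q α) :=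
  ⟨h.1, card_lowerNbrs_of_hasClassicalParameters h hD hp,
    card_upperNbrs_of_hasClassicalParameters h hD hp⟩

lemma exists_arrayAction_inv_pow (hq₀ : q ≠ 0) (hq₁ : q ≠ 1) (D : ℕ) (α β : ℝ) :
    ∃ lam μ : ℝ, ∀ i, arrayAction (classicalB D q α β) (classicalC q α) (q⁻¹ ^ ·) i =
      lam * q⁻¹ ^ i + μ := by
  have hq₂ : q - 1 ≠ 0 := sub_ne_zero.2 hq₁
  refine ⟨classicalB D q α β 0 - (1 - α / (q - 1)) - q ^ D / q * (β + α / (q - 1)),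
    1 - α / (q - 1) - α / (q * (q - 1)) + q⁻¹ * (β + α / (q - 1)) + q ^ D / q * (α / (q - 1)),
    fun i => ?_⟩
  simp only [arrayAction, classicalC, classicalB, qBracket_eq hq₁]
  rcases i with _ | i
  · simp
    field_simp
    ring
  · simp only [Nat.add_sub_cancel, pow_succ, inv_pow]
    have hqi : q ^ i ≠ 0 := pow_ne_zero i hq₀
    generalize q ^ i = t at hqi
    field_simp
    ring

omit [Fintype X] in
lemma exists_posSemidef_inv_pow [Finite X] (h : G.IsDistanceRegularWith p) (hD : 1 ≤ G.diam)
    (hp : HasClassicalParameters p G.diam q α β) (hq : q < -1) :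
    ∃ m, (distMatrix G fun i => q⁻¹ ^ i - m).PosSemidef := by
  have := Fintype.ofFinite X
  have := nontrivial_of_diam_ne_zero (G := G) (by omega)
  obtain ⟨lam, μ, hrec⟩ := exists_arrayAction_inv_pow (by linarith : q ≠ 0) (by linarith) G.diam α β
  refine exists_posSemidef_distMatrix_sub h (hasIntersectionArray_classical h hD hp)
    (fun i hi => ?_) fun u v => hrec _
  have habs : |q⁻¹| < 1 := by
    rw [abs_inv, abs_of_neg (by linarith)]
    exact inv_lt_one_of_one_lt₀ (by linarith)
  calc q⁻¹ ^ i ≤ |q⁻¹| ^ i := by rw [← abs_pow]; exact le_abs_self _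
    _ < q⁻¹ ^ 0 := by rw [pow_zero]; exact pow_lt_one₀ (abs_nonneg _) habs hi

end ClassicalParameters

section NegativeType

variable {X : Type*} {G : SimpleGraph X} {p : ℕ → ℕ → ℕ → ℕ} {q α β : ℝ}
  {u v w : X}

/-- `G` is a distance-regular graph of negative type `(D, q, α, β)` with `a₁ = 0`. -/
structure IsTriangleFreeNegativeType (G : SimpleGraph X) (p : ℕ → ℕ → ℕ → ℕ) (q α β : ℝ) :
    Prop where
  isDistanceRegularWith : G.IsDistanceRegularWith p
  one_le_diam : 1 ≤ G.diam
  hasClassicalParameters : HasClassicalParameters p G.diam q α β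
  lt_neg_one : q < -1
  intersection_one_one_one : p 1 1 1 = 0

namespace IsTriangleFreeNegativeType

lemma connected (h : IsTriangleFreeNegativeType G p q α β) : G.Connected :=
  h.isDistanceRegularWith.1

lemma ne_zero (h : IsTriangleFreeNegativeType G p q α β) : q ≠ 0 := by
  linarith [h.lt_neg_one]

lemma hasIntersectionArray [Fintype X] (h : IsTriangleFreeNegativeType G p q α β) :
    HasIntersectionArray G (classicalB G.diam q α β) (classicalC q α) :=
  hasIntersectionArray_classical h.isDistanceRegularWith h.one_le_diam h.hasClassicalParameters

variable [Finite X]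

lemma not_adj_of_adj (h : IsTriangleFreeNegativeType G p q α β) (hvu : G.Adj v u)
    (hvw : G.Adj v w) : ¬ G.Adj u w := by
  intro huw
  have hempty := h.isDistanceRegularWith.2 1 1 1 h.one_le_diam h.one_le_diam h.one_le_diam u w
    (dist_eq_one_iff_adj.2 huw)
  rw [h.intersection_one_one_one, Set.ncard_eq_zero, Set.eq_empty_iff_forall_notMem] at hempty
  exact hempty v ⟨dist_eq_one_iff_adj.2 hvu.symm, dist_eq_one_iff_adj.2 hvw.symm⟩

lemma dist_eq_two (h : IsTriangleFreeNegativeType G p q α β) (hvu : G.Adj v u)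
    (hvw : G.Adj v w) (huw : u ≠ w) : G.dist u w = 2 := by
  have hle := dist_right_cases hvw u
  rw [dist_eq_one_iff_adj.2 hvu.symm] at hle
  have := h.connected.one_lt_dist_of_ne_of_not_adj huw (h.not_adj_of_adj hvu hvw)
  omega

lemma beta_eq (h : IsTriangleFreeNegativeType G p q α β) :
    β = 1 - α * (qBracket q G.diam - 1) := by
  have := Fintype.ofFinite X
  have := nontrivial_of_diam_ne_zero (G := G) (by have := h.one_le_diam; omega)
  obtain ⟨x, y, hxy⟩ := exists_pair_ne X
  obtain ⟨z, hz⟩ := lowerNbrs_nonempty h.connected hxy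
  have hyz : G.dist y z = 1 := dist_eq_one_iff_adj.2 (mem_lowerNbrs.1 hz).1
  by_contra hβ
  obtain ⟨w, hzw, hyw⟩ := h.hasIntersectionArray.exists_adj_dist_eq (x := y) (y := z) (by
    simp only [hyz, classicalC_one, classicalB, qBracket_zero, qBracket_one]
    exact fun he => hβ (by linear_combination -he))
  exact h.not_adj_of_adj (mem_lowerNbrs.1 hz).1.symm hzw
    (dist_eq_one_iff_adj.1 (hyw.trans hyz))

lemma classicalB_zero_sub (h : IsTriangleFreeNegativeType G p q α β) (i : ℕ) :
    classicalB G.diam q α β 0 - classicalB G.diam q α β i - classicalC q α i =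
      α * qBracket q i * (1 - qBracket q i - qBracket q (i - 1)) := by
  simp only [classicalB, classicalC, h.beta_eq, qBracket_zero]
  ring

end IsTriangleFreeNegativeType

end NegativeType

section Edge

variable {X : Type*} [Fintype X] {G : SimpleGraph X} {b c : ℕ → ℝ} {w x y z : X}

lemma filter_lowerNbrs_eq (hxz : G.Adj x z) (hy : G.dist x y = G.dist z y + 1) :
    {w ∈ lowerNbrs G x y | G.dist z w + 1 = G.dist z y} = lowerNbrs G z y := by
  ext w
  have := dist_left_cases hxz w
  simp only [mem_filter, mem_lowerNbrs]
  grind [dist_right_cases]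

lemma HasIntersectionArray.card_filter_lowerNbrs (h : HasIntersectionArray G b c)
    (hxz : G.Adj x z) (hy : G.dist x y = G.dist z y + 1) :
    (#{w ∈ lowerNbrs G x y | G.dist z w = G.dist z y + 1} : ℝ) =
      c (G.dist x y) - c (G.dist z y) - #{w ∈ lowerNbrs G x y | G.dist z w = G.dist z y} := by
  have hadj : ∀ w ∈ lowerNbrs G x y, G.Adj y w := fun w hw => (mem_lowerNbrs.1 hw).1
  have hcard := card_eq_of_adj hadj z
  rw [filter_lowerNbrs_eq hxz hy, h.card_lowerNbrs, h.card_lowerNbrs] at hcard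
  linear_combination -hcard

lemma HasIntersectionArray.sum_lowerNbrs_of_far (h : HasIntersectionArray G b c)
    (hxz : G.Adj x z) (hy : G.dist x y = G.dist z y + 1) (F : ℕ → ℝ) :
    ∑ w ∈ lowerNbrs G x y, F (G.dist z w) = c (G.dist z y) * F (G.dist z y - 1) +
      #{w ∈ lowerNbrs G x y | G.dist z w = G.dist z y} * F (G.dist z y) +
      (c (G.dist x y) - c (G.dist z y) - #{w ∈ lowerNbrs G x y | G.dist z w = G.dist z y}) *
        F (G.dist z y + 1) := by
  rw [sum_dist_of_adj (fun w hw => (mem_lowerNbrs.1 hw).1), filter_lowerNbrs_eq hxz hy,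
    h.card_lowerNbrs, h.card_filter_lowerNbrs hxz hy]

/-- `G` has no parallelogram of length `ℓ`: this is Terwilliger's name for vertices `x, y, z, w`
with `∂(x, y) = ∂(z, w) = 1`, `∂(x, z) = ℓ` and `∂(x, w) = ∂(y, z) = ∂(y, w) = ℓ - 1`. For `ℓ = 2`
it is a triangle `x, y, w` together with a further vertex `z`. -/
def IsParallelogramFree (G : SimpleGraph X) (ℓ : ℕ) : Prop :=
  ∀ x y z w, G.Adj x y → G.Adj z w → G.dist x z = ℓ → G.dist x w + 1 = ℓ → G.dist y z + 1 = ℓ →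
    G.dist y w + 1 ≠ ℓ

lemma IsParallelogramFree.card_filter_lowerNbrs (hP : IsParallelogramFree G (G.dist x y))
    (hxz : G.Adj x z) (hy : G.dist x y = G.dist z y + 1) :
    #{w ∈ lowerNbrs G x y | G.dist z w = G.dist z y} = 0 := by
  rw [card_eq_zero, filter_eq_empty_iff]
  intro w hw hzw
  rw [mem_lowerNbrs] at hw
  exact hP x z y w hxz hw.1 rfl hw.2 hy.symm (by rw [hzw, hy])

lemma HasIntersectionArray.sum_lowerNbrs_of_isParallelogramFree (h : HasIntersectionArray G b c)
    (hP : IsParallelogramFree G (G.dist x y)) (hxz : G.Adj x z)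
    (hy : G.dist x y = G.dist z y + 1) (F : ℕ → ℝ) :
    ∑ w ∈ lowerNbrs G x y, F (G.dist z w) = c (G.dist z y) * F (G.dist z y - 1) +
      (c (G.dist x y) - c (G.dist z y)) * F (G.dist z y + 1) := by
  rw [h.sum_lowerNbrs_of_far hxz hy, hP.card_filter_lowerNbrs hxz hy]
  simp

lemma IsParallelogramFree.dist_eq_of_mem_upperNbrs (hP : IsParallelogramFree G (G.dist x y + 1))
    (hxz : G.Adj x z) (hy : G.dist z y ≤ G.dist x y) (hw : w ∈ upperNbrs G x y) :
    G.dist z w = G.dist z y + 1 := by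
  rw [mem_upperNbrs] at hw
  have := dist_right_cases hw.1 z
  have := dist_left_cases hxz w
  have := hP x z w y hxz hw.1.symm hw.2 rfl
  omega

lemma HasIntersectionArray.sum_upperNbrs_of_near (h : HasIntersectionArray G b c)
    (hP : IsParallelogramFree G (G.dist z y)) (hxz : G.Adj x z)
    (hy : G.dist z y = G.dist x y + 1) (F : ℕ → ℝ) :
    ∑ w ∈ upperNbrs G x y, F (G.dist z w) =
      (c (G.dist z y) - c (G.dist x y)) * F (G.dist x y) +
      (b (G.dist x y) - b (G.dist z y) - (c (G.dist z y) - c (G.dist x y))) * F (G.dist z y) +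
      b (G.dist z y) * F (G.dist z y + 1) := by
  have hadj : ∀ w ∈ upperNbrs G x y, G.Adj y w := fun w hw => (mem_upperNbrs.1 hw).1
  have hlower : {w ∈ upperNbrs G x y | G.dist z w + 1 = G.dist z y} =
      {w ∈ lowerNbrs G z y | G.dist x w = G.dist x y + 1} := by
    ext w
    simp only [mem_filter, mem_lowerNbrs, mem_upperNbrs]
    tauto
  have hupper : {w ∈ upperNbrs G x y | G.dist z w = G.dist z y + 1} = upperNbrs G z y := by
    ext w
    have := dist_left_cases hxz w
    simp only [mem_filter, mem_upperNbrs]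
    grind [dist_right_cases]
  have hcard := card_eq_of_adj hadj z
  have hlowerCard := h.card_filter_lowerNbrs hxz.symm hy
  rw [hP.card_filter_lowerNbrs hxz.symm hy, Nat.cast_zero, sub_zero] at hlowerCard
  rw [hlower, hlowerCard, hupper, h.card_upperNbrs, h.card_upperNbrs] at hcard
  rw [sum_dist_of_adj hadj, hlower, hlowerCard, hupper, h.card_upperNbrs]
  rw [show G.dist z y - 1 = G.dist x y by omega]
  linear_combination -F (G.dist z y) * hcard

end Edge

section Balanced

variable {X : Type*} [Fintype X] {G : SimpleGraph X} {p : ℕ → ℕ → ℕ → ℕ} {q α β κ : ℝ}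
  {x y z v : X} {θ : ℕ → ℝ} {i : ℕ}

open Classical in
/-- For vertices `y, z` at distance `i`, the characteristic vector of the neighbours of `y` at
distance `i - 1` from `z`, minus that of the neighbours of `z` at distance `i - 1` from `y`, minus
`κ` times the difference of the characteristic vectors of `y` and `z`. -/
noncomputable def balanceVec (G : SimpleGraph X) (κ : ℝ) (y z w : X) : ℝ :=
  (if w ∈ lowerNbrs G z y then 1 else 0) - (if w ∈ lowerNbrs G y z then 1 else 0) -
    κ * ((if w = y then 1 else 0) - (if w = z then 1 else 0))

lemma distMatrix_mulVec_balanceVec (θ : ℕ → ℝ) (κ : ℝ) (y z v : X) :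
    (distMatrix G θ *ᵥ balanceVec G κ y z) v =
      ∑ w ∈ lowerNbrs G z y, θ (G.dist v w) - ∑ w ∈ lowerNbrs G y z, θ (G.dist v w) -
        κ * (θ (G.dist v y) - θ (G.dist v z)) := by
  classical
  simp only [mulVec, dotProduct, distMatrix, of_apply, balanceVec, mul_sub, sum_sub_distrib,
    mul_ite, mul_one, mul_zero, sum_ite_mem, univ_inter, sum_ite_eq', mem_univ, if_true]
  ring

lemma balanceVec_swap (G : SimpleGraph X) (κ : ℝ) (y z : X) :
    balanceVec G κ z y = -balanceVec G κ y z := by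
  ext w
  simp only [balanceVec, Pi.neg_apply]
  ring

lemma balanceVec_of_mem_lowerNbrs (hyz : 2 < G.dist y z) (hv : v ∈ lowerNbrs G y z) :
    balanceVec G κ y z v = -1 := by
  have hv' := mem_lowerNbrs.1 hv
  have hvz : v ∉ lowerNbrs G z y := fun hw => by
    have := dist_eq_one_iff_adj.2 (mem_lowerNbrs.1 hw).1
    omega
  have hvy : v ≠ y := by
    rintro rfl
    rw [SimpleGraph.dist_self] at hv'
    omega
  simp [balanceVec, hv, hvz, hvy, hv'.1.ne']

lemma HasIntersectionArray.sum_balanceVec {b c : ℕ → ℝ} (h : HasIntersectionArray G b c) :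
    ∑ w, balanceVec G κ y z w = 0 := by
  classical
  simp only [balanceVec, sum_sub_distrib, ← mul_sum, sum_ite_mem, univ_inter, sum_ite_eq',
    mem_univ, if_true, sum_const, nsmul_eq_mul, h.card_lowerNbrs, G.dist_comm (u := z)]
  ring

/-- The coefficient `κ` for which `balanceVec G κ y z` is expected in the kernel of the matrix
`q⁻¹ ^ ∂(u, v)` when `∂(y, z) = i`; it is forced by the entry at `y`. The truncated subtraction is
harmless, since only `2 ≤ i` matters. -/
noncomputable def balanceCoeff (q α : ℝ) (i : ℕ) : ℝ :=
  q * qBracket q (i - 2) * (1 + α * qBracket q (i - 1))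

/-- Terwilliger's balanced set condition, for the vertices at distance `i` and the eigenspace
spanned by the columns of `q⁻¹ ^ ∂(u, v)` modulo the constants. -/
def IsBalanced (G : SimpleGraph X) (q α : ℝ) (i : ℕ) : Prop :=
  ∀ y z, G.dist y z = i →
    distMatrix G (q⁻¹ ^ ·) *ᵥ balanceVec G (balanceCoeff q α i) y z = 0

lemma IsBalanced.sum_lowerNbrs_sub (hB : IsBalanced G q α i) (hyz : G.dist y z = i) (v : X) :
    ∑ w ∈ lowerNbrs G z y, q⁻¹ ^ G.dist v w - ∑ w ∈ lowerNbrs G y z, q⁻¹ ^ G.dist v w =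
      balanceCoeff q α i * (q⁻¹ ^ G.dist v y - q⁻¹ ^ G.dist v z) := by
  have := congr_fun (hB y z hyz) v
  rw [distMatrix_mulVec_balanceVec, Pi.zero_apply] at this
  linarith

namespace IsTriangleFreeNegativeType

omit [Fintype X] in
lemma isParallelogramFree_two [Finite X] (h : IsTriangleFreeNegativeType G p q α β) :
    IsParallelogramFree G 2 := by
  intro x y z w hxy _ _ hxw _ hyw
  have hxw : G.Adj x w := dist_eq_one_iff_adj.1 (by omega)
  exact h.not_adj_of_adj hxy hxw (dist_eq_one_iff_adj.1 (by omega))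

lemma mulVec_balanceVec_left (h : IsTriangleFreeNegativeType G p q α β)
    (hyz : G.dist y z = i + 2) :
    (distMatrix G (q⁻¹ ^ ·) *ᵥ balanceVec G (balanceCoeff q α (i + 2)) y z) y = 0 := by
  have hnear : ∀ w ∈ lowerNbrs G z y, q⁻¹ ^ G.dist y w = q⁻¹ := fun w hw => by
    rw [dist_eq_one_iff_adj.2 (mem_lowerNbrs.1 hw).1, pow_one]
  have hfar : ∀ w ∈ lowerNbrs G y z, q⁻¹ ^ G.dist y w = q⁻¹ ^ (i + 1) := fun w hw => by
    rw [show G.dist y w = i + 1 by rw [mem_lowerNbrs] at hw; omega]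
  have hq : q - 1 ≠ 0 := by linarith [h.lt_neg_one]
  rw [distMatrix_mulVec_balanceVec, sum_congr rfl hnear, sum_congr rfl hfar]
  simp only [sum_const, nsmul_eq_mul, h.hasIntersectionArray.card_lowerNbrs, G.dist_comm (u := z),
    hyz, SimpleGraph.dist_self, balanceCoeff, classicalC, qBracket_eq (sub_ne_zero.1 hq),
    Nat.add_sub_cancel, show i + 2 - 1 = i + 1 by omega, inv_pow]
  have := h.ne_zero
  field_simp
  ring

lemma sum_lowerNbrs_inv_pow_self (h : IsTriangleFreeNegativeType G p q α β)
    (hx : x ∈ lowerNbrs G y z) :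
    ∑ w ∈ lowerNbrs G y z, q⁻¹ ^ G.dist x w =
      1 + (classicalC q α (G.dist y z) - 1) * q⁻¹ ^ 2 := by
  classical
  have htwo : ∀ w ∈ (lowerNbrs G y z).erase x, q⁻¹ ^ G.dist x w = q⁻¹ ^ 2 := by
    intro w hw
    rw [mem_erase, mem_lowerNbrs] at hw
    rw [h.dist_eq_two (mem_lowerNbrs.1 hx).1 hw.2.1 hw.1.symm]
  rw [← add_sum_erase _ _ hx, SimpleGraph.dist_self, pow_zero, sum_congr rfl htwo, sum_const,
    nsmul_eq_mul, cast_card_erase_of_mem hx, h.hasIntersectionArray.card_lowerNbrs]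

lemma mulVec_balanceVec_of_mem_lowerNbrs (h : IsTriangleFreeNegativeType G p q α β)
    (hyz : G.dist y z = i + 2) (hx : x ∈ lowerNbrs G y z) :
    (distMatrix G (q⁻¹ ^ ·) *ᵥ balanceVec G (balanceCoeff q α (i + 2)) y z) x =
      #{w ∈ lowerNbrs G z y | G.dist x w = i + 1} * (q⁻¹ ^ (i + 1) - q⁻¹ ^ (i + 2)) := by
  have hx' := mem_lowerNbrs.1 hx
  have hxy : G.dist x y = i + 1 := by rw [G.dist_comm]; omega
  have hzy : G.dist z y = i + 2 := by rw [G.dist_comm, hyz]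
  have hq : q - 1 ≠ 0 := by linarith [h.lt_neg_one]
  rw [distMatrix_mulVec_balanceVec, h.sum_lowerNbrs_inv_pow_self hx,
    h.hasIntersectionArray.sum_lowerNbrs_of_far hx'.1 (by omega) (q⁻¹ ^ ·), hxy, hzy, hyz,
    dist_eq_one_iff_adj.2 hx'.1.symm]
  generalize (#{w ∈ lowerNbrs G z y | G.dist x w = i + 1} : ℝ) = N
  simp only [balanceCoeff, classicalC, qBracket_eq (sub_ne_zero.1 hq), Nat.add_sub_cancel,
    show i + 2 - 1 = i + 1 by omega, inv_pow]
  have := h.ne_zero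
  field_simp
  ring

lemma isBalanced_of_odd (h : IsTriangleFreeNegativeType G p q α β) (hi : Odd i) :
    IsBalanced G q α (i + 2) := by
  intro y z hyz
  have hpos : 0 < i := hi.pos
  have hq : q⁻¹ < 0 := inv_lt_zero.2 (by linarith [h.lt_neg_one])
  have hgap : 0 < q⁻¹ ^ (i + 1) - q⁻¹ ^ (i + 2) := by
    rw [pow_succ _ (i + 1), ← mul_one_sub]
    exact mul_pos (hi.add_one.pow_pos hq.ne) (by linarith)
  have hmem : ∀ {y z}, G.dist y z = i + 2 → ∀ v ∈ lowerNbrs G y z,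
      balanceVec G (balanceCoeff q α (i + 2)) y z v *
        (distMatrix G (q⁻¹ ^ ·) *ᵥ balanceVec G (balanceCoeff q α (i + 2)) y z) v ≤ 0 := by
    intro y z hyz v hv
    rw [balanceVec_of_mem_lowerNbrs (by omega) hv,
      h.mulVec_balanceVec_of_mem_lowerNbrs hyz hv, neg_one_mul, neg_nonpos]
    positivity
  have hzy : G.dist z y = i + 2 := by rw [G.dist_comm, hyz]
  refine distMatrix_mulVec_eq_zero (exists_posSemidef_inv_pow h.isDistanceRegularWith
    h.one_le_diam h.hasClassicalParameters h.lt_neg_one) h.hasIntersectionArray.sum_balanceVec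
    fun v => ?_
  by_cases hvy : v = y
  · rw [hvy, h.mulVec_balanceVec_left hyz, mul_zero]
  by_cases hvz : v = z
  · rw [← neg_mul_neg, ← Pi.neg_apply (f := _ *ᵥ _), ← mulVec_neg, ← balanceVec_swap, hvz,
      h.mulVec_balanceVec_left hzy, mul_zero]
  by_cases hv : v ∈ lowerNbrs G y z
  · exact hmem hyz v hv
  by_cases hv' : v ∈ lowerNbrs G z y
  · rw [← neg_mul_neg, ← Pi.neg_apply (f := _ *ᵥ _), ← mulVec_neg, ← Pi.neg_apply,
      ← balanceVec_swap]
    exact hmem hzy v hv'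
  · simp [balanceVec, hvy, hvz, hv, hv']

lemma isParallelogramFree_of_isBalanced (h : IsTriangleFreeNegativeType G p q α β)
    (hB : IsBalanced G q α (i + 2)) : IsParallelogramFree G (i + 2) := by
  intro x y z w hxy hzw hxz hxw hyz hyw
  have hw : w ∈ lowerNbrs G x z := mem_lowerNbrs.2 ⟨hzw, by omega⟩
  have hy : y ∈ {u ∈ lowerNbrs G z x | G.dist w u = i + 1} := by
    simp only [mem_filter, mem_lowerNbrs, G.dist_comm (u := z), G.dist_comm (u := w)]
    exact ⟨⟨hxy, by omega⟩, by omega⟩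
  have hq : q⁻¹ < 0 := inv_lt_zero.2 (by linarith [h.lt_neg_one])
  have hzero := h.mulVec_balanceVec_of_mem_lowerNbrs hxz hw
  rw [hB x z hxz, Pi.zero_apply, pow_succ _ (i + 1), ← mul_one_sub, eq_comm, mul_eq_zero,
    Nat.cast_eq_zero, card_eq_zero] at hzero
  exact hzero.elim (ne_empty_of_mem hy) (mul_ne_zero (pow_ne_zero _ hq.ne) (by linarith))

end IsTriangleFreeNegativeType

end Balanced

section DistanceFour

variable {X : Type*} [Fintype X] {G : SimpleGraph X} {p : ℕ → ℕ → ℕ → ℕ} {b c : ℕ → ℝ}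
  {q α β : ℝ} {y z v : X} {i : ℕ}

lemma HasIntersectionArray.sum_lowerNbrs_lowerNbrs_swap (h : HasIntersectionArray G b c)
    (y z : X) (g : X → ℝ) :
    ∑ u ∈ lowerNbrs G y z, ∑ w ∈ lowerNbrs G u y, g w =
      c (G.dist y z - 1) * ∑ w ∈ lowerNbrs G z y, g w := by
  rw [sum_comm' (t' := lowerNbrs G z y) (s' := fun w => lowerNbrs G w z), mul_sum]
  · refine sum_congr rfl fun w hw => ?_
    rw [mem_lowerNbrs, G.dist_comm (u := z) (v := y), G.dist_comm (u := z)] at hw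
    rw [sum_const, nsmul_eq_mul, h.card_lowerNbrs, ← hw.2, Nat.add_sub_cancel]
  · intro u w
    simp only [mem_lowerNbrs, G.dist_comm (u := z), G.dist_comm (u := u)]
    constructor <;> rintro ⟨⟨hzu, hyu⟩, hyw, hwu⟩
    · have := dist_right_cases hzu w
      have := dist_left_cases hyw z
      exact ⟨⟨hzu, by omega⟩, hyw, by omega⟩
    · have := dist_right_cases hzu y
      have := dist_left_cases hyw u
      exact ⟨⟨hzu, by omega⟩, hyw, by omega⟩

lemma HasIntersectionArray.sum_lowerNbrs_lowerNbrs (h : HasIntersectionArray G b c)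
    (y z : X) (g : X → ℝ) :
    ∑ u ∈ lowerNbrs G y z, ∑ w ∈ lowerNbrs G y u, g w =
      c 2 * ∑ w with G.dist y w + 2 = G.dist y z ∧ G.dist z w = 2, g w := by
  rw [sum_comm' (t' := {w | G.dist y w + 2 = G.dist y z ∧ G.dist z w = 2})
    (s' := fun w => lowerNbrs G w z), mul_sum]
  · refine sum_congr rfl fun w hw => ?_
    rw [sum_const, nsmul_eq_mul, h.card_lowerNbrs, G.dist_comm, (mem_filter.1 hw).2.2]
  · intro u w
    simp only [mem_lowerNbrs, mem_filter, mem_univ, true_and, G.dist_comm (u := z)]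
    constructor
    · rintro ⟨⟨hzu, hyu⟩, huw, hyw⟩
      have := dist_right_cases hzu w
      have := h.connected.dist_triangle (u := y) (v := w) (w := z)
      have := dist_eq_one_iff_adj.2 huw.symm
      exact ⟨⟨hzu, by omega⟩, by omega, by omega⟩
    · rintro ⟨⟨hzu, hwu⟩, hyw, hwz⟩
      have hwu : G.Adj w u := dist_eq_one_iff_adj.1 (by omega)
      have := dist_right_cases hwu y
      have := dist_right_cases hzu y
      exact ⟨⟨hzu, by omega⟩, hwu.symm, by omega⟩

namespace IsTriangleFreeNegativeType

omit [Fintype X] in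
lemma isParallelogramFree_three [Finite X] (h : IsTriangleFreeNegativeType G p q α β) :
    IsParallelogramFree G 3 :=
  have := Fintype.ofFinite X
  h.isParallelogramFree_of_isBalanced (h.isBalanced_of_odd odd_one)

lemma sum_lowerNbrs_of_isBalanced (h : IsTriangleFreeNegativeType G p q α β)
    (hB : IsBalanced G q α i) (hyz : G.dist y z = i + 1) (v : X) :
    classicalC q α i * ∑ w ∈ lowerNbrs G z y, q⁻¹ ^ G.dist v w -
        classicalC q α 2 *
          ∑ w with G.dist y w + 2 = i + 1 ∧ G.dist z w = 2, q⁻¹ ^ G.dist v w =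
      balanceCoeff q α i * (classicalC q α (i + 1) * q⁻¹ ^ G.dist v y -
        ∑ w ∈ lowerNbrs G y z, q⁻¹ ^ G.dist v w) := by
  have hswap := h.hasIntersectionArray.sum_lowerNbrs_lowerNbrs_swap y z (q⁻¹ ^ G.dist v ·)
  have htwo := h.hasIntersectionArray.sum_lowerNbrs_lowerNbrs y z (q⁻¹ ^ G.dist v ·)
  rw [hyz, Nat.add_sub_cancel] at hswap
  rw [hyz] at htwo
  have hbal : ∀ u ∈ lowerNbrs G y z,
      ∑ w ∈ lowerNbrs G u y, q⁻¹ ^ G.dist v w - ∑ w ∈ lowerNbrs G y u, q⁻¹ ^ G.dist v w =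
        balanceCoeff q α i * (q⁻¹ ^ G.dist v y - q⁻¹ ^ G.dist v u) := fun u hu =>
    hB.sum_lowerNbrs_sub (by rw [mem_lowerNbrs] at hu; omega) v
  rw [← hswap, ← htwo, ← sum_sub_distrib, sum_congr rfl hbal, ← mul_sum, sum_sub_distrib,
    sum_const, nsmul_eq_mul, h.hasIntersectionArray.card_lowerNbrs, hyz]

omit [Fintype X] in
lemma classicalC_pos [Finite X] (h : IsTriangleFreeNegativeType G p q α β)
    (hi : 0 < G.dist y z) : 0 < classicalC q α (G.dist y z) := by
  have := Fintype.ofFinite X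
  rw [← h.hasIntersectionArray.card_lowerNbrs, Nat.cast_pos, card_pos]
  exact lowerNbrs_nonempty h.connected (by rintro rfl; simp at hi)

lemma isBalanced_four (h : IsTriangleFreeNegativeType G p q α β) : IsBalanced G q α 4 := by
  intro y z hyz
  have hB : IsBalanced G q α 3 := h.isBalanced_of_odd odd_one
  obtain ⟨u, hu⟩ := lowerNbrs_nonempty h.connected (x := y) (y := z)
    (by rintro rfl; simp at hyz)
  rw [mem_lowerNbrs, hyz] at hu
  have hyu : G.dist y u = 3 := by omega
  have hpos := h.classicalC_pos (y := y) (z := u) (by omega)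
  rw [hyu] at hpos
  have hne : classicalC q α 3 - balanceCoeff q α 3 ≠ 0 := by
    have hq := h.lt_neg_one
    rw [classicalC] at hpos ⊢
    rw [balanceCoeff, ← sub_mul, qBracket_three, qBracket_one]
    exact mul_ne_zero (by nlinarith) (right_ne_zero_of_mul hpos.ne')
  ext v
  have hy := h.sum_lowerNbrs_of_isBalanced hB hyz v
  have hz := h.sum_lowerNbrs_of_isBalanced hB (G.dist_comm.trans hyz) v
  simp only [Nat.reduceAdd, Nat.reduceEqDiff, and_comm (a := G.dist z _ = 2)] at hy hz
  rw [distMatrix_mulVec_balanceVec]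
  refine mul_left_cancel₀ hne ?_
  have hcoeff : balanceCoeff q α 3 * classicalC q α 4 =
      (classicalC q α 3 - balanceCoeff q α 3) * balanceCoeff q α 4 := by
    simp only [balanceCoeff, classicalC, Nat.reduceSub, qBracket_one, qBracket_two,
      qBracket_three, qBracket_four]
    ring
  simp only [Pi.zero_apply]
  linear_combination hy - hz + (q⁻¹ ^ G.dist v y - q⁻¹ ^ G.dist v z) * hcoeff

omit [Fintype X] in
lemma isParallelogramFree_four [Finite X] (h : IsTriangleFreeNegativeType G p q α β) :
    IsParallelogramFree G 4 :=
  have := Fintype.ofFinite X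
  h.isParallelogramFree_of_isBalanced h.isBalanced_four

end IsTriangleFreeNegativeType

end DistanceFour

section EdgePartition

variable {X : Type*} [Fintype X] {G : SimpleGraph X} {p : ℕ → ℕ → ℕ → ℕ} {b c F : ℕ → ℝ}
  {q α β : ℝ} {x y z : X} {g : X → ℝ} {i j : ℕ}

/-- The lowering operator of `G` with respect to `x`. -/
noncomputable def lowering (G : SimpleGraph X) (x : X) (g : X → ℝ) (y : X) : ℝ :=
  ∑ w ∈ upperNbrs G x y, g w

/-- The raising operator of `G` with respect to `x`. -/
noncomputable def raising (G : SimpleGraph X) (x : X) (g : X → ℝ) (y : X) : ℝ :=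
  ∑ w ∈ lowerNbrs G x y, g w

lemma HasIntersectionArray.lowering_eq_of_le (h : HasIntersectionArray G b c)
    (hP : IsParallelogramFree G (i + 1)) (hxz : G.Adj x z) {t : ℝ}
    (hg : ∀ w, G.dist x w = i + 1 → G.dist z w = j + 1 → g w = t) (hji : j ≤ i)
    (hxy : G.dist x y = i) (hzy : G.dist z y = j) : lowering G x g y = b i * t := by
  subst hxy hzy
  have ht : ∀ w ∈ upperNbrs G x y, g w = t := fun w hw =>
    hg w (mem_upperNbrs.1 hw).2 (hP.dist_eq_of_mem_upperNbrs hxz hji hw)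
  rw [lowering, sum_congr rfl ht, sum_const, nsmul_eq_mul, h.card_upperNbrs]

/-- For adjacent `x, z`, a function `F` of `∂(z, w)` on the vertices `w` with `∂(x, w) = i + 1` is
lowered to a function of `∂(z, y)` on the vertices `y` with `∂(x, y) = i`, provided that there are
no parallelograms of length `i + 1`; this is its value at `∂(z, y) = j`. -/
noncomputable def edgeLowering (b c F : ℕ → ℝ) (i j : ℕ) : ℝ :=
  if j ≤ i then b i * F (j + 1)
  else (c (i + 1) - c i) * F i + (b i - b (i + 1) - (c (i + 1) - c i)) * F (i + 1) +
    b (i + 1) * F (i + 2)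

lemma HasIntersectionArray.lowering_eq (h : HasIntersectionArray G b c)
    (hP : IsParallelogramFree G (i + 1)) (hxz : G.Adj x z)
    (hg : ∀ w, G.dist x w = i + 1 → g w = F (G.dist z w)) (hxy : G.dist x y = i) :
    lowering G x g y = edgeLowering b c F i (G.dist z y) := by
  rcases le_or_gt (G.dist z y) i with hzy | hzy
  · rw [edgeLowering, if_pos hzy]
    exact h.lowering_eq_of_le hP hxz (fun w hxw hzw => by rw [hg w hxw, hzw]) hzy hxy rfl
  · have hzy' : G.dist z y = i + 1 := by
      have := dist_left_cases hxz y
      omega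
    rw [edgeLowering, if_neg hzy.not_ge]
    have hsum := h.sum_upperNbrs_of_near (by rwa [hzy']) hxz (by rw [hzy', hxy]) F
    rw [hxy, hzy'] at hsum
    exact (sum_congr rfl fun w hw => hg w (by rw [mem_upperNbrs] at hw; omega)).trans hsum

lemma HasIntersectionArray.raising_eq_of_far (h : HasIntersectionArray G b c)
    (hP : IsParallelogramFree G (i + 2)) (hxz : G.Adj x z)
    (hg : ∀ w, G.dist x w = i + 1 → g w = F (G.dist z w)) (hxy : G.dist x y = i + 2)
    (hzy : G.dist z y = i + 1) :
    raising G x g y = c (i + 1) * F i + (c (i + 2) - c (i + 1)) * F (i + 2) := by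
  have hsum := h.sum_lowerNbrs_of_isParallelogramFree (by rwa [hxy]) hxz
    (by rw [hxy, hzy]) F
  rw [hxy, hzy, Nat.add_sub_cancel] at hsum
  exact (sum_congr rfl fun w hw => hg w (by rw [mem_lowerNbrs] at hw; omega)).trans hsum

namespace IsTriangleFreeNegativeType

lemma raising_eq_of_dist_eq_two (h : IsTriangleFreeNegativeType G p q α β) (hxz : G.Adj x z)
    (hg : ∀ w, G.dist x w = 1 → g w = F (G.dist z w)) (hxy : G.dist x y = 2)
    (hzy : G.dist z y = 2) : raising G x g y = classicalC q α 2 * F 2 := by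
  have hterm : ∀ w ∈ lowerNbrs G x y, g w = F 2 := by
    intro w hw
    rw [mem_lowerNbrs, hxy] at hw
    have hxw : G.dist x w = 1 := by omega
    have hzw : z ≠ w := by
      rintro rfl
      have := dist_eq_one_iff_adj.2 hw.1.symm
      omega
    rw [hg w hxw, h.dist_eq_two hxz (dist_eq_one_iff_adj.1 hxw) hzw]
  rw [raising, sum_congr rfl hterm, sum_const, nsmul_eq_mul,
    h.hasIntersectionArray.card_lowerNbrs, hxy]

lemma sum_lowerNbrs_inv_pow_of_dist_eq_three (h : IsTriangleFreeNegativeType G p q α β)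
    (hxz : G.Adj x z) (hxy : G.dist x y = 3) (hzy : G.dist z y = 3) :
    ∑ w ∈ lowerNbrs G x y, q⁻¹ ^ G.dist z w =
      classicalC q α 3 * q⁻¹ ^ 2 + balanceCoeff q α 3 * (q⁻¹ ^ 3 - q⁻¹) := by
  have hyx : G.dist y x = 3 := by rw [G.dist_comm, hxy]
  have hbal := (h.isBalanced_of_odd odd_one).sum_lowerNbrs_sub hyx z
  have htwo : ∀ w ∈ lowerNbrs G y x, q⁻¹ ^ G.dist z w = q⁻¹ ^ 2 := by
    intro w hw
    rw [mem_lowerNbrs] at hw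
    have hzw : z ≠ w := by
      rintro rfl
      rw [G.dist_comm (u := y)] at hw
      omega
    rw [h.dist_eq_two hxz hw.1 hzw]
  rw [sum_congr rfl htwo, sum_const, nsmul_eq_mul, h.hasIntersectionArray.card_lowerNbrs, hyx, hzy,
    dist_eq_one_iff_adj.2 hxz.symm, pow_one] at hbal
  linarith

lemma raising_eq_of_dist_eq_three (h : IsTriangleFreeNegativeType G p q α β)
    (hxz : G.Adj x z) (hg : ∀ w, G.dist x w = 2 → g w = F (G.dist z w)) (hxy : G.dist x y = 3)
    (hzy : G.dist z y = 3) :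
    raising G x g y = balanceCoeff q α 3 * (1 + q) * F 3 +
      (classicalC q α 3 - balanceCoeff q α 3 * (1 + q)) * F 2 := by
  have hadj : ∀ w ∈ lowerNbrs G x y, G.Adj y w := fun w hw => (mem_lowerNbrs.1 hw).1
  have hfour : #{w ∈ lowerNbrs G x y | G.dist z w = 3 + 1} = 0 := by
    refine card_eq_zero.2 (filter_false_of_mem fun w hw => ?_)
    have := dist_left_cases hxz w
    rw [mem_lowerNbrs] at hw
    omega
  have hcard := card_eq_of_adj hadj z
  have hpow := h.sum_lowerNbrs_inv_pow_of_dist_eq_three hxz hxy hzy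
  have hsum := sum_dist_of_adj hadj z F
  rw [sum_dist_of_adj hadj z (q⁻¹ ^ ·)] at hpow
  rw [h.hasIntersectionArray.card_lowerNbrs] at hcard
  simp only [hxy, hzy, hfour, Nat.cast_zero, zero_mul, add_zero, Nat.reduceSub]
    at hcard hpow hsum
  have hthree : (#{w ∈ lowerNbrs G x y | G.dist z w = 3} : ℝ) = balanceCoeff q α 3 * (1 + q) := by
    have hq := h.ne_zero
    have hq₁ : 1 - q ≠ 0 := by linarith [h.lt_neg_one]
    field_simp at hpow
    refine mul_left_cancel₀ hq₁ ?_
    linear_combination hpow + q * hcard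
  rw [raising, sum_congr rfl fun w hw => hg w (by rw [mem_lowerNbrs] at hw; omega), hsum, hthree]
  linear_combination -F 2 * (hcard + hthree)

end IsTriangleFreeNegativeType

end EdgePartition

section Relations

variable {X : Type*} {G : SimpleGraph X} {p : ℕ → ℕ → ℕ → ℕ} {q α β e₁ e₂ f : ℝ}
  {x y z : X} {i : ℕ}

/-- The characteristic function of the vertices at distance `i` from `x` and `j` from `z`. -/
noncomputable def edgeCell (G : SimpleGraph X) (x z : X) (i j : ℕ) (w : X) : ℝ :=
  if G.dist x w = i ∧ G.dist z w = j then 1 else 0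

lemma edgeCell_eq_zero (j : ℕ) (hy : G.dist x y ≠ i) : edgeCell G x z i j y = 0 :=
  if_neg fun h => hy h.1

lemma edgeCell_eq_single (j : ℕ) (hy : G.dist x y = i) :
    edgeCell G x z i j y = (Pi.single j 1 : ℕ → ℝ) (G.dist z y) := by
  simp [edgeCell, hy, Pi.single_apply]

lemma exists_dist_eq_of_le_dist (hG : G.Connected) (hi : i ≤ G.dist x y) :
    ∃ w, G.dist x w = i := by
  induction hi using Nat.decreasingInduction with
  | self => exact ⟨y, rfl⟩
  | of_succ i _ ih =>
    obtain ⟨w, hw⟩ := ih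
    obtain ⟨u, hu⟩ := exists_adj_dist_add_one hG (x := x) (y := w) (by rintro rfl; simp at hw)
    exact ⟨u, by omega⟩

lemma exists_dist_eq_of_le_diam [Finite X] (h : G.IsDistanceRegularWith p) (hi : i ≤ G.diam)
    (x : X) : ∃ y, G.dist x y = i := by
  have := h.1.nonempty
  obtain ⟨u, v, huv⟩ := G.exists_dist_eq_diam
  obtain ⟨w, hw⟩ := exists_dist_eq_of_le_dist h.1 (huv ▸ hi)
  have hcard : ∀ y, {w | G.dist y w = i}.ncard = p 0 i i := fun y => by
    simpa using h.2 0 i i (Nat.zero_le _) hi hi y y G.dist_self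
  have hpos : 0 < p 0 i i := by
    rw [← hcard u, Set.ncard_pos]
    exact ⟨w, hw⟩
  rwa [← hcard x, Set.ncard_pos] at hpos

variable [Fintype X]

/-- The relation `e₁ R L² + L R L + e₂ L² R = f L` with respect to `x`, on the functions supported
by the vertices at distance `i` from `x`. -/
def UniformRelation (G : SimpleGraph X) (x : X) (i : ℕ) (e₁ e₂ f : ℝ) : Prop :=
  ∀ g : X → ℝ, (∀ v, G.dist x v ≠ i → g v = 0) → ∀ y,
    e₁ * raising G x (lowering G x (lowering G x g)) y +
        lowering G x (raising G x (lowering G x g)) y +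
        e₂ * lowering G x (lowering G x (raising G x g)) y =
      f * lowering G x g y

namespace IsTriangleFreeNegativeType

omit [Fintype X] in
lemma alpha_lt_neg_one [Finite X] (h : IsTriangleFreeNegativeType G p q α β)
    (hxy : G.dist x y = 2) : α < -1 := by
  have hc₂ := h.classicalC_pos (y := x) (z := y) (by omega)
  have hq := h.lt_neg_one
  rw [hxy, classicalC, qBracket_two, qBracket_one] at hc₂
  nlinarith

lemma lowering_edgeCell_three (h : IsTriangleFreeNegativeType G p q α β) (hxz : G.Adj x z) (j : ℕ)
    (hy : G.dist x y = 2) :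
    lowering G x (edgeCell G x z 3 j) y =
      edgeLowering (classicalB G.diam q α β) (classicalC q α) (Pi.single j 1) 2 (G.dist z y) :=
  h.hasIntersectionArray.lowering_eq h.isParallelogramFree_three hxz
    (fun _ => edgeCell_eq_single j) hy

lemma lowering_lowering_edgeCell_three (h : IsTriangleFreeNegativeType G p q α β)
    (hxz : G.Adj x z) (j : ℕ) (hy : G.dist x y = 1) :
    lowering G x (lowering G x (edgeCell G x z 3 j)) y =
      edgeLowering (classicalB G.diam q α β) (classicalC q α)
        (edgeLowering (classicalB G.diam q α β) (classicalC q α) (Pi.single j 1) 2) 1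
        (G.dist z y) :=
  h.hasIntersectionArray.lowering_eq h.isParallelogramFree_two hxz
    (fun _ => h.lowering_edgeCell_three hxz j) hy

lemma relation_of_dist_eq_two (h : IsTriangleFreeNegativeType G p q α β)
    (hrel : UniformRelation G x 3 e₁ e₂ f) (hxz : G.Adj x z) (hxy : G.dist x y = 2)
    (hzy : G.dist z y = 2) (hb : classicalB G.diam q α β 2 ≠ 0) :
    e₁ * (classicalC q α 2 * (classicalC q α 3 - 1)) +
      balanceCoeff q α 3 * (1 + q) * (classicalC q α 3 - classicalC q α 2) = 0 := by
  have hRLL := h.raising_eq_of_dist_eq_two hxz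
    (fun _ => h.lowering_lowering_edgeCell_three hxz 2) hxy hzy
  have hLRL := h.hasIntersectionArray.lowering_eq_of_le h.isParallelogramFree_three hxz
    (fun _ => h.raising_eq_of_dist_eq_three hxz fun _ => h.lowering_edgeCell_three hxz 2)
    le_rfl hxy hzy
  have hfar : ∀ w, G.dist x w = 4 → G.dist z w = 4 →
      raising G x (edgeCell G x z 3 2) w = 0 := fun w _ hzw =>
    sum_eq_zero fun v hv => if_neg fun hxv => by
      have := dist_right_cases (mem_lowerNbrs.1 hv).1 z
      omega
  have hLLR := h.hasIntersectionArray.lowering_eq_of_le h.isParallelogramFree_three hxz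
    (fun _ => h.hasIntersectionArray.lowering_eq_of_le h.isParallelogramFree_four hxz hfar le_rfl)
    le_rfl hxy hzy
  have hrel := hrel (edgeCell G x z 3 2) (fun _ => edgeCell_eq_zero 2) y
  rw [hRLL, hLRL, hLLR, h.lowering_edgeCell_three hxz 2 hxy, hzy] at hrel
  refine mul_left_cancel₀ hb ?_
  simp only [edgeLowering, classicalC_one, ↓reduceIte, Nat.reduceAdd, Nat.reduceLeDiff,
    Nat.reduceEqDiff, Nat.not_ofNat_le_one, Nat.one_le_ofNat, Nat.succ_ne_self, Std.le_refl, ne_eq,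
    not_false_eq_true, Pi.single_eq_same, Pi.single_eq_of_ne, mul_one, mul_zero, add_zero] at hrel
  linear_combination hrel

lemma relation_of_dist_eq_one (h : IsTriangleFreeNegativeType G p q α β)
    (hrel : UniformRelation G x 3 e₁ e₂ f) (hxz : G.Adj x z) (hxy : G.dist x y = 2)
    (hzy : G.dist z y = 1) (hb : classicalB G.diam q α β 2 ≠ 0) :
    e₁ * ((classicalC q α 2 - 1) * (-α * (1 + q) ^ 2 * (1 + q + q ^ 2))) +
      (classicalC q α 3 - classicalC q α 2) * (-α * (1 + q) ^ 2 * (q * (1 + q))) = 0 := by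
  have hRLL := h.hasIntersectionArray.raising_eq_of_far h.isParallelogramFree_two hxz
    (fun _ => h.lowering_lowering_edgeCell_three hxz 3) hxy hzy
  have hLRL := h.hasIntersectionArray.lowering_eq_of_le h.isParallelogramFree_three hxz
    (fun _ => h.hasIntersectionArray.raising_eq_of_far h.isParallelogramFree_three hxz
      fun _ => h.lowering_edgeCell_three hxz 3) one_le_two hxy hzy
  have hLLR := h.hasIntersectionArray.lowering_eq_of_le h.isParallelogramFree_three hxz
    (fun _ => h.hasIntersectionArray.lowering_eq_of_le h.isParallelogramFree_four hxz
      (fun _ => h.hasIntersectionArray.raising_eq_of_far h.isParallelogramFree_four hxz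
        fun _ => edgeCell_eq_single 3) (by norm_num)) one_le_two hxy hzy
  have hrel := hrel (edgeCell G x z 3 3) (fun _ => edgeCell_eq_zero 3) y
  rw [hRLL, hLRL, hLLR, h.lowering_edgeCell_three hxz 3 hxy, hzy] at hrel
  refine mul_left_cancel₀ hb ?_
  have ha₁ := h.classicalB_zero_sub 1
  have ha₂ := h.classicalB_zero_sub 2
  have ha₃ := h.classicalB_zero_sub 3
  simp only [edgeLowering, classicalC_one, ↓reduceIte, Nat.reduceAdd, Nat.reduceLeDiff,
    Nat.reduceEqDiff, Nat.not_ofNat_le_one, Nat.one_le_ofNat, Nat.succ_ne_self, Std.le_refl, ne_eq,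
    not_false_eq_true, Pi.single_eq_same, Pi.single_eq_of_ne, mul_one, mul_zero, add_zero, zero_add,
    zero_le] at hrel
  simp only [qBracket_zero, qBracket_one, qBracket_two, qBracket_three, classicalC_one,
    Nat.reduceSub] at ha₁ ha₂ ha₃
  linear_combination hrel + e₁ * (classicalC q α 2 - 1) * classicalB G.diam q α β 2 * (ha₁ - ha₃) +
    classicalB G.diam q α β 2 * (classicalC q α 3 - classicalC q α 2) * (ha₂ - ha₃)

end IsTriangleFreeNegativeType

lemma relations_incompatible {q α e : ℝ} (hq : q < -1) (hα : α < -1)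
    (h₂ : e * (classicalC q α 2 * (classicalC q α 3 - 1)) +
      balanceCoeff q α 3 * (1 + q) * (classicalC q α 3 - classicalC q α 2) = 0)
    (h₁ : e * ((classicalC q α 2 - 1) * (-α * (1 + q) ^ 2 * (1 + q + q ^ 2))) +
      (classicalC q α 3 - classicalC q α 2) * (-α * (1 + q) ^ 2 * (q * (1 + q))) = 0) : False := by
  have hc₃ : classicalC q α 3 = (1 + α * (1 + q)) * (1 + q + q ^ 2) := by
    rw [classicalC, qBracket_three, qBracket_two, mul_comm]
  have hκ : balanceCoeff q α 3 = q * (1 + α * (1 + q)) := by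
    rw [balanceCoeff, qBracket_one, qBracket_two, mul_one]
  have hγ : 0 < classicalC q α 3 - classicalC q α 2 := by
    have hqq : 0 < q * (q + α * (1 + q) ^ 2) := by
      refine mul_pos_of_neg_of_neg (by linarith) ?_
      nlinarith [mul_nonneg (by linarith : 0 ≤ -α) (sq_nonneg (1 + q))]
    rw [classicalC, classicalC, qBracket_three, qBracket_two, qBracket_one]
    linear_combination hqq
  have hne : -α * (1 + q) ^ 2 ≠ 0 :=
    mul_ne_zero (by linarith) (pow_ne_zero 2 (by linarith))
  have h₁' : e * ((classicalC q α 2 - 1) * (1 + q + q ^ 2)) +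
      (classicalC q α 3 - classicalC q α 2) * (q * (1 + q)) = 0 :=
    mul_left_cancel₀ hne (by linear_combination h₁)
  have he : e * (classicalC q α 3 - classicalC q α 2) = 0 := by
    rw [hκ] at h₂
    linear_combination h₂ - (1 + α * (1 + q)) * h₁' - e * (classicalC q α 2 - 1) * hc₃
  rw [(mul_eq_zero.1 he).resolve_right hγ.ne', zero_mul, zero_add] at h₁'
  exact (mul_pos hγ (mul_pos_of_neg_of_neg (by linarith) (by linarith))).ne' h₁'

lemma IsTriangleFreeNegativeType.not_uniformRelation (h : IsTriangleFreeNegativeType G p q α β)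
    (hD : 3 ≤ G.diam) (x : X) : ¬ UniformRelation G x 3 e₁ e₂ f := by
  intro hrel
  obtain ⟨y₃, hxy₃⟩ := exists_dist_eq_of_le_diam h.isDistanceRegularWith hD x
  obtain ⟨y, hy⟩ := lowerNbrs_nonempty h.connected (x := x) (y := y₃)
    (by rintro rfl; simp at hxy₃)
  rw [mem_lowerNbrs, hxy₃] at hy
  have hxy : G.dist x y = 2 := by omega
  have hyx : G.dist y x = 2 := by rw [dist_comm, hxy]
  have hq := h.lt_neg_one
  have hα := h.alpha_lt_neg_one hxy
  have hb₂ : classicalB G.diam q α β 2 ≠ 0 := by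
    rw [← hxy, ← h.hasIntersectionArray.card_upperNbrs, Nat.cast_ne_zero]
    exact card_ne_zero_of_mem (mem_upperNbrs.2 ⟨hy.1.symm, by omega⟩)
  have ha₂ : classicalC q α 2 + classicalB G.diam q α β 2 ≠ classicalB G.diam q α β 0 := by
    have hne : -α * (1 + q) ^ 2 ≠ 0 :=
      mul_ne_zero (by linarith) (pow_ne_zero 2 (by linarith))
    have hsub := h.classicalB_zero_sub 2
    rw [qBracket_two, qBracket_one] at hsub
    exact fun he => hne (by linear_combination -he - hsub)
  obtain ⟨z₁, hz₁⟩ := lowerNbrs_nonempty h.connected (x := y) (y := x)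
    (by rintro rfl; simp at hyx)
  rw [mem_lowerNbrs] at hz₁
  obtain ⟨z₂, hxz₂, hyz₂⟩ := h.hasIntersectionArray.exists_adj_dist_eq (x := y) (y := x)
    (by rwa [hyx])
  exact relations_incompatible hq hα
    (h.relation_of_dist_eq_two hrel hxz₂ hxy (by rw [G.dist_comm, hyz₂, hyx]) hb₂)
    (h.relation_of_dist_eq_one hrel hz₁.1 hxy (by rw [G.dist_comm]; omega) hb₂)

end Relations

section FlatDeleted

variable {X : Type*} {G : SimpleGraph X} {x y z : X} {i : ℕ}

lemma flatDeleted_le (G : SimpleGraph X) (x : X) : G.flatDeleted x ≤ G := fun _ _ h => h.1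

lemma exists_flatDeleted_walk (hG : G.Connected) (x y : X) :
    ∃ p : (G.flatDeleted x).Walk x y, p.length = G.dist x y := by
  induction hn : G.dist x y generalizing y with
  | zero =>
    obtain rfl := hG.dist_eq_zero_iff.1 hn
    exact ⟨.nil, rfl⟩
  | succ n ih =>
    obtain ⟨w, hw⟩ := exists_adj_dist_add_one hG (x := x) (y := y) (by rintro rfl; simp at hn)
    obtain ⟨p, hp⟩ := ih w (by omega)
    have hwy : (G.flatDeleted x).Adj w y := ⟨hw.1.symm, by omega⟩
    exact ⟨p.concat hwy, by rw [Walk.length_concat, hp]⟩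

lemma flatDeleted_connected (hG : G.Connected) (x : X) : (G.flatDeleted x).Connected :=
  (connected_iff_exists_forall_reachable _).2
    ⟨x, fun y => (exists_flatDeleted_walk hG x y).choose.reachable⟩

lemma dist_flatDeleted (hG : G.Connected) (x y : X) :
    (G.flatDeleted x).dist x y = G.dist x y := by
  obtain ⟨p, hp⟩ := exists_flatDeleted_walk hG x y
  exact le_antisymm (hp ▸ dist_le p) (p.reachable.dist_anti (flatDeleted_le G x))

lemma dist_le_eccentricity [Finite X] (hG : G.Connected) (x y : X) :
    G.dist x y ≤ G.eccentricity x := by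
  have := hG.nonempty
  have hne : G.eccent x ≠ ⊤ :=
    ne_top_of_le_ne_top (connected_iff_ediam_ne_top.1 hG) (eccent_le_ediam (u := x))
  rw [eccentricity, ← Nat.cast_le (α := ℕ∞), ENat.natCast_toNat hne, (hG x y).coe_dist_eq_edist]
  exact edist_le_eccent

lemma le_eccentricity_flatDeleted [Finite X] {p : ℕ → ℕ → ℕ → ℕ}
    (h : G.IsDistanceRegularWith p) (hi : i ≤ G.diam) (x : X) :
    i ≤ (G.flatDeleted x).eccentricity x := by
  obtain ⟨y, hy⟩ := exists_dist_eq_of_le_diam h hi x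
  calc i = (G.flatDeleted x).dist x y := by rw [dist_flatDeleted h.1, hy]
    _ ≤ _ := dist_le_eccentricity (flatDeleted_connected h.1 x) x y

variable [Fintype X]

lemma upperNbrs_flatDeleted (hG : G.Connected) (x y : X) :
    upperNbrs (G.flatDeleted x) x y = upperNbrs G x y := by
  ext w
  simp only [mem_upperNbrs, dist_flatDeleted hG]
  exact ⟨fun h => ⟨h.1.1, h.2⟩, fun h => ⟨⟨h.1, by omega⟩, h.2⟩⟩

lemma lowerNbrs_flatDeleted (hG : G.Connected) (x y : X) :
    lowerNbrs (G.flatDeleted x) x y = lowerNbrs G x y := by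
  ext w
  simp only [mem_lowerNbrs, dist_flatDeleted hG]
  exact ⟨fun h => ⟨h.1.1, h.2⟩, fun h => ⟨⟨h.1, by omega⟩, h.2⟩⟩

lemma uniformRelation_flatDeleted {e₁ e₂ f : ℝ} (hG : G.Connected) :
    UniformRelation (G.flatDeleted x) x i e₁ e₂ f ↔ UniformRelation G x i e₁ e₂ f := by
  simp only [UniformRelation, lowering, raising, upperNbrs_flatDeleted hG,
    lowerNbrs_flatDeleted hG, dist_flatDeleted hG]

end FlatDeleted

section ComplexMatrices

variable {X : Type*} [Fintype X] [DecidableEq X] {G : SimpleGraph X} {x : X} {i : ℕ}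

open Classical in
lemma dualIdempotent_mul_mul_apply (G : SimpleGraph X) (x : X) (i j : ℕ) (y w : X) :
    (G.dualIdempotent x i * G.complexAdjMatrix * G.dualIdempotent x j) y w =
      if G.dist x w = j ∧ G.Adj y w ∧ G.dist x y = i then 1 else 0 := by
  simp only [dualIdempotent, complexAdjMatrix, Matrix.mul_diagonal, Matrix.diagonal_mul,
    adjMatrix_apply, mul_ite, mul_one, mul_zero, ite_and]

lemma loweringMatrix_apply (hG : G.Connected) (x y w : X) :
    G.loweringMatrix x y w = if w ∈ upperNbrs G x y then 1 else 0 := by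
  classical
  have := dist_le_eccentricity hG x w
  simp only [loweringMatrix, Matrix.sum_apply, dualIdempotent_mul_mul_apply, ite_and, sum_ite_eq]
  simp only [← ite_and, mem_Icc, mem_upperNbrs]
  refine if_congr ⟨fun h => ⟨h.2.1, by omega⟩, fun h => ⟨by omega, h.1, by omega⟩⟩ rfl rfl

lemma raisingMatrix_apply (hG : G.Connected) (x y w : X) :
    G.raisingMatrix x y w = if w ∈ lowerNbrs G x y then 1 else 0 := by
  classical
  have := dist_le_eccentricity hG x y
  simp only [raisingMatrix, Matrix.sum_apply, dualIdempotent_mul_mul_apply, ite_and, sum_ite_eq]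
  simp only [← ite_and, mem_range, mem_lowerNbrs]
  refine if_congr ⟨fun h => ⟨h.2.1, by omega⟩, fun h => ⟨by omega, h.1, by omega⟩⟩ rfl rfl

lemma loweringMatrix_mulVec (hG : G.Connected) (x : X) (g : X → ℝ) :
    G.loweringMatrix x *ᵥ (fun v => (g v : ℂ)) = fun v => (lowering G x g v : ℂ) := by
  ext y
  simp only [mulVec, dotProduct, loweringMatrix_apply hG, lowering, ite_mul, one_mul, zero_mul,
    sum_ite_mem, univ_inter, Complex.ofReal_sum]

lemma raisingMatrix_mulVec (hG : G.Connected) (x : X) (g : X → ℝ) :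
    G.raisingMatrix x *ᵥ (fun v => (g v : ℂ)) = fun v => (raising G x g v : ℂ) := by
  ext y
  simp only [mulVec, dotProduct, raisingMatrix_apply hG, raising, ite_mul, one_mul, zero_mul,
    sum_ite_mem, univ_inter, Complex.ofReal_sum]

lemma mem_subconstituent_of_forall {v : X → ℂ} (hv : ∀ y, G.dist x y ≠ i → v y = 0) :
    v ∈ G.subconstituent x i := by
  refine ⟨v, funext fun y => ?_⟩
  simp only [dualIdempotent, mulVecLin_apply, mulVec_diagonal, ite_mul, one_mul, zero_mul,
    ite_eq_left_iff]
  exact fun hy => (hv y hy).symm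

lemma uniformRelation_re {e₁ e₂ f : ℂ} (hG : G.Connected)
    (hrel : ∀ v ∈ G.subconstituent x i,
      (e₁ • (G.raisingMatrix x * G.loweringMatrix x ^ 2) +
          G.loweringMatrix x * G.raisingMatrix x * G.loweringMatrix x +
          e₂ • (G.loweringMatrix x ^ 2 * G.raisingMatrix x)) *ᵥ v =
        (f • G.loweringMatrix x) *ᵥ v) :
    UniformRelation G x i e₁.re e₂.re f.re := by
  intro g hg y
  have h := congrFun (hrel (fun v => (g v : ℂ))
    (mem_subconstituent_of_forall fun v hv => by rw [hg v hv, Complex.ofReal_zero])) y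
  simp only [add_mulVec, smul_mulVec, pow_two, ← mulVec_mulVec, loweringMatrix_mulVec hG,
    raisingMatrix_mulVec hG, Pi.add_apply, Pi.smul_apply, smul_eq_mul] at h
  simpa using congrArg Complex.re h

end ComplexMatrices

end DistanceRegular

theorem theorem7p2_general {X : Type*} [Fintype X] [DecidableEq X] (Γ : SimpleGraph X)
    (p : ℕ → ℕ → ℕ → ℕ) (hΓ : Γ.IsDistanceRegularWith p) (hD : 3 ≤ Γ.diam)
    (hneg : SimpleGraph.IsNegativeType p Γ.diam) (ha₁ : p 1 1 1 = 0) (x : X) (e₁ e₂ f : ℂ) :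
    ¬ ∀ v ∈ (Γ.flatDeleted x).subconstituent x 3,
      (e₁ • ((Γ.flatDeleted x).raisingMatrix x * (Γ.flatDeleted x).loweringMatrix x ^ 2) +
          (Γ.flatDeleted x).loweringMatrix x * (Γ.flatDeleted x).raisingMatrix x *
            (Γ.flatDeleted x).loweringMatrix x +
          e₂ • ((Γ.flatDeleted x).loweringMatrix x ^ 2 * (Γ.flatDeleted x).raisingMatrix x)) *ᵥ v =
        (f • (Γ.flatDeleted x).loweringMatrix x) *ᵥ v := by
  intro hrel
  obtain ⟨q, α, β, hp, hq⟩ := hneg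
  have hG : DistanceRegular.IsTriangleFreeNegativeType Γ p q α β :=
    ⟨hΓ, by omega, hp, hq, ha₁⟩
  have hflat := DistanceRegular.uniformRelation_re
    (DistanceRegular.flatDeleted_connected hΓ.1 x) hrel
  exact hG.not_uniformRelation hD x ((DistanceRegular.uniformRelation_flatDeleted hΓ.1).1 hflat)

theorem theorem7p2 {X : Type*} [Fintype X] [DecidableEq X] (Γ : SimpleGraph X)
    (p : ℕ → ℕ → ℕ → ℕ) (hΓ : Γ.IsDistanceRegularWith p) (hbip : ¬ Γ.IsBipartite)
    (hD : 3 ≤ Γ.diam) (hneg : SimpleGraph.IsNegativeType p Γ.diam) (ha₁ : p 1 1 1 = 0)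
    (x : X) :
    ¬ Γ.SupportsUniformStructure x := fun ⟨_, _, hU⟩ =>
  theorem7p2_general Γ p hΓ hD hneg ha₁ x _ _ _ <| hU.uniform 3 <| Finset.mem_Icc.2
    ⟨by norm_num, DistanceRegular.le_eccentricity_flatDeleted hΓ hD x⟩
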